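/- All rings are commutative with unity. A Gorenstein local ring is a Noetherian local ring $R$ that has finite injective dimension as an $R$-module. For $R$-modules $M$ and $N$ put $$p^R(M,N)=\sup\{\, i\in\mathbb N=\{0,1,2,\dots\} \mid \operatorname{Ext}^i_R(M,N)\neq 0\,\}\in\mathbb N\cup\{\infty\}$$ (with $\sup\emptyset=0$), and let $$\xi(R)=\sup\{\, p^R(M,N) \mid M,N \text{ are } R\text{-modules},\ M \text{ is finitely generated, and } p^R(M,N)<\infty \,\}\in\mathbb N\cup\{\infty\}.$$ Let $R$ be an Artinian Gorenstein local ring with $\xi(R)<\infty$. Let $M$ and $N$ be $R$-modules, where $M$ is finitely generated and $N$ is arbitrary. If $\operatorname{Ext}^i_R(N,M)=0$ for all $i\gg 0$ (that is, there is an $n$ such that $\operatorname{Ext}^i_R(N,M)=0$ for all $i\geq n$), then $$\operatorname{Ext}^i_R(M,N)=0\quad\text{for all } i>0.$$ -/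

import Mathlib

open CategoryTheory

universe u

/-- A Gorenstein local ring: a commutative Noetherian local ring that has finite injective
dimension as a module over itself. -/
class IsGorensteinLocalRing (R : Type u) [CommRing R] : Prop extends
    IsLocalRing R, IsNoetherianRing R where
  exists_hasInjectiveDimensionLE : ∃ n : ℕ, HasInjectiveDimensionLE (ModuleCat.of R R) n

/-- `p^R(M, N) = sup {i ∈ ℕ | Ext^i_R(M, N) ≠ 0}`, with value in `ℕ∞`; the value is `0` if all
the modules `Ext^i_R(M, N)` vanish (in particular if `M` or `N` is zero). -/
noncomputable def extSup (R : Type u) [CommRing R] (M N : ModuleCat.{u} R) : ℕ∞ :=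
  sSup {k : ℕ∞ | ∃ i : ℕ, k = (i : ℕ∞) ∧ Nontrivial (Abelian.Ext.{u} M N i)}

/-- `ξ(R)`, the supremum of the finite values of `p^R(M, N)`, where `M` is a finitely generated
`R`-module and `N` is an arbitrary `R`-module. -/
noncomputable def extXi (R : Type u) [CommRing R] : ℕ∞ :=
  sSup {k : ℕ∞ | k < ⊤ ∧ ∃ M N : ModuleCat.{u} R, Module.Finite R M ∧ k = extSup R M N}

/-! Write `X*` for `Hom(X, R)`. The ring is self-injective, so `(-)*` is exact and `M ≅ M**`;
swapping arguments turns vanishing of `Ext^i(N, M**)` into vanishing of `Ext^i(M*, N*)` for large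
`i` (`subsingleton_ext_dual`). A presentation `0 → K → F → M → 0` dualizes to one making `M*` a
syzygy of `K*`. Shifting past `ξ(R)` along such cosyzygies upgrades eventual vanishing to `Ext^i(M*,
N*) = 0` for all `i > 0`. By tensor-hom adjunction, `- ⊗ N` then keeps the relevant dual sequences
exact, so `M* ⊗ N → Hom(M, N)` is onto, for `M` and for its syzygies. Maps `K → N` thus come from
`K* ⊗ N`, onto which `F* ⊗ N` surjects, so they extend to `F`: `Ext¹(M, N) = 0`. -/

open CategoryTheory Abelian Module

/-! ### Long exact sequences and dimension shifting for Ext. -/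

section ExtShift

variable {R : Type u} [CommRing R] {A B C : Type u} [AddCommGroup A] [AddCommGroup B]
  [AddCommGroup C] [Module R A] [Module R B] [Module R C]

/-- The short exact sequence in `ModuleCat R` given by linear maps. -/
theorem shortExact_of_linearMap {f : A →ₗ[R] B} {g : B →ₗ[R] C} (hf : Function.Injective f)
    (hfg : Function.Exact f g) (hg : Function.Surjective g) :
    (ModuleCat.shortComplexOfCompEqZero f g hfg.linearMap_comp_eq_zero).ShortExact :=
  ModuleCat.shortComplex_shortExact _ hfg hf hg

theorem subsingleton_ext_middle_left {f : A →ₗ[R] B} {g : B →ₗ[R] C} (hf : Function.Injective f)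
    (hfg : Function.Exact f g) (hg : Function.Surjective g) (Y : ModuleCat.{u} R) (i : ℕ)
    (hA : Subsingleton (Ext.{u} (ModuleCat.of R A) Y i))
    (hC : Subsingleton (Ext.{u} (ModuleCat.of R C) Y i)) :
    Subsingleton (Ext.{u} (ModuleCat.of R B) Y i) := by
  refine subsingleton_of_forall_eq 0 fun e ↦ ?_
  obtain ⟨x, rfl⟩ := Ext.contravariant_sequence_exact₂ (shortExact_of_linearMap hf hfg hg) Y e
    (hA.elim _ _)
  rw [hC.elim x 0, Ext.comp_zero]

theorem subsingleton_ext_left_of_middle_of_right {f : A →ₗ[R] B} {g : B →ₗ[R] C}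
    (hf : Function.Injective f) (hfg : Function.Exact f g) (hg : Function.Surjective g)
    (Y : ModuleCat.{u} R) (i : ℕ) (hB : Subsingleton (Ext.{u} (ModuleCat.of R B) Y i))
    (hC : Subsingleton (Ext.{u} (ModuleCat.of R C) Y (i + 1))) :
    Subsingleton (Ext.{u} (ModuleCat.of R A) Y i) := by
  refine subsingleton_of_forall_eq 0 fun e ↦ ?_
  obtain ⟨x, rfl⟩ := Ext.contravariant_sequence_exact₁ (shortExact_of_linearMap hf hfg hg) Y e
    (add_comm 1 i) (hC.elim _ _)
  rw [hB.elim x 0, Ext.comp_zero]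

theorem subsingleton_ext_right_of_left {f : A →ₗ[R] B} {g : B →ₗ[R] C}
    (hf : Function.Injective f) (hfg : Function.Exact f g) (hg : Function.Surjective g)
    (Y : ModuleCat.{u} R) (i : ℕ) (hB : Subsingleton (Ext.{u} (ModuleCat.of R B) Y (i + 1)))
    (hA : Subsingleton (Ext.{u} (ModuleCat.of R A) Y i)) :
    Subsingleton (Ext.{u} (ModuleCat.of R C) Y (i + 1)) := by
  refine subsingleton_of_forall_eq 0 fun e ↦ ?_
  obtain ⟨x, rfl⟩ := Ext.contravariant_sequence_exact₃ (shortExact_of_linearMap hf hfg hg) Y e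
    (hB.elim _ _) (add_comm 1 i)
  rw [hA.elim x 0, Ext.comp_zero]

theorem subsingleton_ext_of_projective [Module.Projective R B] (Y : ModuleCat.{u} R) {i : ℕ}
    (hi : 0 < i) : Subsingleton (Ext.{u} (ModuleCat.of R B) Y i) := by
  obtain ⟨i, rfl⟩ := Nat.exists_eq_succ_of_ne_zero hi.ne'
  have : CategoryTheory.Projective (ModuleCat.of R B) :=
    (IsProjective.iff_projective B).mp inferInstance
  exact Ext.subsingleton_of_projective _ _ _

theorem subsingleton_ext_of_injective [Module.Injective R B] (X : ModuleCat.{u} R) {i : ℕ}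
    (hi : 0 < i) : Subsingleton (Ext.{u} X (ModuleCat.of R B) i) := by
  obtain ⟨i, rfl⟩ := Nat.exists_eq_succ_of_ne_zero hi.ne'
  have : CategoryTheory.Injective (ModuleCat.of R B) :=
    (Module.injective_iff_injective_object R B).mp inferInstance
  exact Ext.subsingleton_of_injective _ _ _

/-- Dimension shifting along a short exact sequence with projective middle term. -/
theorem subsingleton_ext_succ_iff_of_projective {f : A →ₗ[R] B} {g : B →ₗ[R] C}
    (hf : Function.Injective f) (hfg : Function.Exact f g) (hg : Function.Surjective g)
    [Module.Projective R B] (Y : ModuleCat.{u} R) {i : ℕ} (hi : 0 < i) :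
    Subsingleton (Ext.{u} (ModuleCat.of R C) Y (i + 1)) ↔
      Subsingleton (Ext.{u} (ModuleCat.of R A) Y i) :=
  ⟨subsingleton_ext_left_of_middle_of_right hf hfg hg Y i (subsingleton_ext_of_projective Y hi),
    subsingleton_ext_right_of_left hf hfg hg Y i
      (subsingleton_ext_of_projective Y i.succ_pos)⟩

/-- If `Ext¹(C, Y) = 0`, maps to `Y` extend from `A` to `B`. -/
theorem exists_extension_of_subsingleton_ext {f : A →ₗ[R] B} {g : B →ₗ[R] C}
    (hf : Function.Injective f) (hfg : Function.Exact f g) (hg : Function.Surjective g)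
    {Y : Type u} [AddCommGroup Y] [Module R Y]
    (h : Subsingleton (Ext.{u} (ModuleCat.of R C) (ModuleCat.of R Y) 1)) (φ : A →ₗ[R] Y) :
    ∃ ψ : B →ₗ[R] Y, ψ ∘ₗ f = φ := by
  obtain ⟨x, hx⟩ := Ext.contravariant_sequence_exact₁ (shortExact_of_linearMap hf hfg hg)
    (ModuleCat.of R Y) (Ext.mk₀ (ModuleCat.ofHom φ)) (add_zero 1) (h.elim _ _)
  obtain ⟨ψ, rfl⟩ := Ext.mk₀_bijective _ _ |>.surjective x
  rw [Ext.mk₀_comp_mk₀] at hx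
  have := (Ext.mk₀_bijective _ _).injective hx
  exact ⟨ψ.hom, congrArg ModuleCat.Hom.hom this⟩

/-- If maps to `Y` extend from `A` to the projective module `B`, then `Ext¹(C, Y) = 0`. -/
theorem subsingleton_ext_one_of_exists_extension {f : A →ₗ[R] B} {g : B →ₗ[R] C}
    (hf : Function.Injective f) (hfg : Function.Exact f g) (hg : Function.Surjective g)
    [Module.Projective R B] {Y : Type u} [AddCommGroup Y] [Module R Y]
    (h : ∀ φ : A →ₗ[R] Y, ∃ ψ : B →ₗ[R] Y, ψ ∘ₗ f = φ) :
    Subsingleton (Ext.{u} (ModuleCat.of R C) (ModuleCat.of R Y) 1) := by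
  refine subsingleton_of_forall_eq 0 fun e ↦ ?_
  have hS := shortExact_of_linearMap hf hfg hg
  obtain ⟨x, rfl⟩ := Ext.contravariant_sequence_exact₃ hS (ModuleCat.of R Y) e
    ((subsingleton_ext_of_projective _ one_pos).elim _ _) (add_zero 1)
  obtain ⟨φ, rfl⟩ := Ext.mk₀_bijective _ _ |>.surjective x
  obtain ⟨ψ, hψ⟩ := h φ.hom
  have : φ = ModuleCat.ofHom f ≫ ModuleCat.ofHom ψ := by ext1; exact hψ.symm
  rw [this, ← Ext.mk₀_comp_mk₀]
  exact hS.extClass_comp_assoc _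

/-- If maps from `X` lift from `C` to the injective module `B`, then `Ext¹(X, A) = 0`. -/
theorem subsingleton_ext_one_of_exists_lift {f : A →ₗ[R] B} {g : B →ₗ[R] C}
    (hf : Function.Injective f) (hfg : Function.Exact f g) (hg : Function.Surjective g)
    [Module.Injective R B] {X : Type u} [AddCommGroup X] [Module R X]
    (h : ∀ φ : X →ₗ[R] C, ∃ ψ : X →ₗ[R] B, g ∘ₗ ψ = φ) :
    Subsingleton (Ext.{u} (ModuleCat.of R X) (ModuleCat.of R A) 1) := by
  refine subsingleton_of_forall_eq 0 fun e ↦ ?_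
  have hS := shortExact_of_linearMap hf hfg hg
  obtain ⟨x, rfl⟩ := Ext.covariant_sequence_exact₁ (ModuleCat.of R X) hS e
    ((subsingleton_ext_of_injective _ one_pos).elim _ _) (zero_add 1)
  obtain ⟨φ, rfl⟩ := Ext.mk₀_bijective _ _ |>.surjective x
  obtain ⟨ψ, hψ⟩ := h φ.hom
  have : φ = ModuleCat.ofHom ψ ≫ ModuleCat.ofHom g := by ext1; exact hψ.symm
  have h0 : (Ext.mk₀ (ModuleCat.ofHom g)).comp hS.extClass (zero_add 1) = 0 := hS.comp_extClass
  rw [this, ← Ext.mk₀_comp_mk₀, Ext.comp_assoc_of_second_deg_zero, h0, Ext.comp_zero]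

/-- Dimension shifting along a short exact sequence with injective middle term. -/
theorem subsingleton_ext_succ_of_injective {f : A →ₗ[R] B} {g : B →ₗ[R] C}
    (hf : Function.Injective f) (hfg : Function.Exact f g) (hg : Function.Surjective g)
    [Module.Injective R B] (X : ModuleCat.{u} R) {i : ℕ}
    (h : Subsingleton (Ext.{u} X (ModuleCat.of R C) i)) :
    Subsingleton (Ext.{u} X (ModuleCat.of R A) (i + 1)) := by
  refine subsingleton_of_forall_eq 0 fun e ↦ ?_
  obtain ⟨x, rfl⟩ := Ext.covariant_sequence_exact₁ X (shortExact_of_linearMap hf hfg hg) e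
    ((subsingleton_ext_of_injective X i.succ_pos).elim _ _) rfl
  rw [h.elim x 0, Ext.zero_comp]

end ExtShift

/-! ### Self-injectivity of Artinian Gorenstein local rings. -/

section SelfInjective

variable {R : Type u} [CommRing R]

/-- The socle is nonzero: an associated prime exists, and the only prime is the maximal ideal. -/
theorem exists_annihilator_eq_maximalIdeal (R : Type u) [CommRing R] [IsArtinianRing R]
    [IsLocalRing R] :
    ∃ y : R, y ≠ 0 ∧ LinearMap.ker (LinearMap.toSpanSingleton R R y) =
      IsLocalRing.maximalIdeal R := by
  obtain ⟨p, hp⟩ := associatedPrimes.nonempty R R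
  have := hp.isPrime
  have hmax : p = IsLocalRing.maximalIdeal R := IsLocalRing.eq_maximalIdeal inferInstance
  obtain ⟨-, y, hy⟩ := isAssociatedPrime_iff.mp hp
  have hker : LinearMap.ker (LinearMap.toSpanSingleton R R y) = IsLocalRing.maximalIdeal R := by
    rw [← hmax, hy]
    ext r
    simp [Submodule.mem_colon_singleton]
  refine ⟨y, ?_, hker⟩
  rintro rfl
  rw [LinearMap.toSpanSingleton_zero, LinearMap.ker_zero] at hker
  exact (IsLocalRing.maximalIdeal.isMaximal R).ne_top hker.symm

/-- Over an Artinian local ring, vanishing of `Ext^{i+1}(-, R)` on finitely generated modules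
descends to `Ext^i(-, R)`. -/
theorem subsingleton_ext_self_of_succ [IsArtinianRing R] [IsLocalRing R] {i : ℕ} (hi : 0 < i)
    (h : ∀ (M : Type u) [AddCommGroup M] [Module R M] [Module.Finite R M],
      Subsingleton (Ext.{u} (ModuleCat.of R M) (ModuleCat.of R R) (i + 1)))
    (M : Type u) [AddCommGroup M] [Module R M] [hM : Module.Finite R M] :
    Subsingleton (Ext.{u} (ModuleCat.of R M) (ModuleCat.of R R) i) := by
  induction hM using IsNoetherianRing.induction_on_isQuotientEquivQuotientPrime R with
  | subsingleton N => exact subsingleton_ext_of_projective _ hi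
  | quotient N p e =>
    obtain ⟨y, -, hy⟩ := exists_annihilator_eq_maximalIdeal R
    have hp : LinearMap.ker (LinearMap.toSpanSingleton R R y) = p.asIdeal :=
      hy.trans (IsLocalRing.eq_maximalIdeal inferInstance).symm
    -- The residue field embeds in `R` through the socle element `y`, so the hypothesis applies to
    -- the finitely generated cokernel.
    let l : R ⧸ p.asIdeal →ₗ[R] R := p.asIdeal.liftQ (LinearMap.toSpanSingleton R R y) hp.ge
    have hl : Function.Injective l :=
      LinearMap.ker_eq_bot.mp (Submodule.ker_liftQ_eq_bot _ _ _ hp.le)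
    let f : N →ₗ[R] R := l ∘ₗ e.toLinearMap
    have hf : Function.Injective f := hl.comp e.injective
    exact subsingleton_ext_left_of_middle_of_right hf (LinearMap.exact_map_mkQ_range f)
      (Submodule.mkQ_surjective _) _ i (subsingleton_ext_of_projective _ hi) (h _)
  | exact N₁ N₂ N₃ f g hf hg hfg h₁ h₃ =>
    exact subsingleton_ext_middle_left hf hfg hg _ i h₁ h₃

/-- An Artinian Gorenstein local ring is self-injective. -/
theorem IsGorensteinLocalRing.injective_self (R : Type u) [CommRing R] [IsArtinianRing R]
    [IsGorensteinLocalRing R] : Module.Injective R R := by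
  obtain ⟨n, hn⟩ := IsGorensteinLocalRing.exists_hasInjectiveDimensionLE (R := R)
  -- Descending induction on the degree: `j` bounds how far `i` lies below `n + 1`.
  have key (j : ℕ) : ∀ i, 0 < i → n + 1 ≤ i + j →
      ∀ (M : Type u) [AddCommGroup M] [Module R M] [Module.Finite R M],
        Subsingleton (Ext.{u} (ModuleCat.of R M) (ModuleCat.of R R) i) := by
    induction j with
    | zero =>
      intro i _ hi M _ _ _
      exact HasInjectiveDimensionLT.subsingleton (ModuleCat.of R R) (n + 1) i hi _
    | succ j ih =>
      intro i hi hij M _ _ _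
      exact subsingleton_ext_self_of_succ hi (fun M ↦ ih (i + 1) i.succ_pos (by omega) M) M
  refine Module.Baer.injective (Module.Baer.iff_surjective.mpr fun I φ ↦ ?_)
  exact exists_extension_of_subsingleton_ext I.injective_subtype
    (LinearMap.exact_subtype_mkQ I) (Submodule.mkQ_surjective _)
    (key n 1 one_pos (by omega) (R ⧸ I)) φ

end SelfInjective

/-! ### Duality into a self-injective ring. -/

section Duality

variable {R : Type u} [CommRing R] {A B C : Type u} [AddCommGroup A] [AddCommGroup B]
  [AddCommGroup C] [Module R A] [Module R B] [Module R C]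

theorem dualMap_surjective_of_injective_self [Module.Injective R R] {f : A →ₗ[R] B}
    (hf : Function.Injective f) : Function.Surjective f.dualMap := fun φ ↦ by
  obtain ⟨ψ, hψ⟩ := Module.Injective.out f hf φ
  exact ⟨ψ, LinearMap.ext hψ⟩

theorem dualMap_exact {f : A →ₗ[R] B} {g : B →ₗ[R] C} (hfg : Function.Exact f g)
    (hg : Function.Surjective g) : Function.Exact g.dualMap f.dualMap :=
  LinearMap.exact_lcomp_of_exact_of_surjective R hfg hg

/-- Extending a map `X → A*` to `Y` amounts, after swapping arguments, to lifting `A → X*` along the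
surjection `Y* → X*`. -/
theorem injective_dual_of_projective [Module.Injective R R] [Module.Projective R A] :
    Module.Injective R (Dual R A) where
  out X Y _ _ _ _ f hf φ := by
    obtain ⟨ψ, hψ⟩ := Module.projective_lifting_property f.dualMap φ.flip
      (dualMap_surjective_of_injective_self hf)
    exact ⟨ψ.flip, fun x ↦ LinearMap.ext fun a ↦ congr($hψ a x)⟩

/-- A self-injective Artinian local ring is a cogenerator. -/
theorem exists_dual_apply_ne_zero [IsArtinianRing R] [IsLocalRing R] [Module.Injective R R]
    {a : A} (ha : a ≠ 0) : ∃ f : Dual R A, f a ≠ 0 := by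
  obtain ⟨y, hy0, hy⟩ := exists_annihilator_eq_maximalIdeal R
  let s := LinearMap.toSpanSingleton R A a
  have hs : LinearMap.ker s ≤ LinearMap.ker (LinearMap.toSpanSingleton R R y) := by
    rw [hy]
    refine IsLocalRing.le_maximalIdeal fun h ↦ ha ?_
    have : (1 : R) ∈ LinearMap.ker s := h ▸ Submodule.mem_top
    simpa [s] using this
  -- The annihilator of `a` kills `y`, so `a ↦ y` is well defined on `Ra` and extends to `A`.
  obtain ⟨f, hf⟩ := Module.Injective.out ((LinearMap.ker s).liftQ s le_rfl)
    (LinearMap.ker_eq_bot.mp (Submodule.ker_liftQ_eq_bot _ _ _ le_rfl))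
    ((LinearMap.ker s).liftQ _ hs)
  refine ⟨f, ?_⟩
  have := hf (Submodule.Quotient.mk 1)
  simp only [Submodule.liftQ_apply, s, LinearMap.toSpanSingleton_apply, one_smul] at this
  rwa [this]

theorem bijective_dual_eval_of_finite [IsArtinianRing R] [IsLocalRing R] [Module.Injective R R]
    [Module.Finite R A] : Function.Bijective (Dual.eval R A) := by
  constructor
  · refine (injective_iff_map_eq_zero _).mpr fun a ha ↦ ?_
    by_contra h
    obtain ⟨f, hf⟩ := exists_dual_apply_ne_zero (R := R) h
    exact hf congr($ha f)
  · obtain ⟨n, p, hp⟩ := Module.Finite.exists_fin' R A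
    intro φ
    obtain ⟨ψ, rfl⟩ := dualMap_surjective_of_injective_self
      (LinearMap.dualMap_injective_of_surjective hp) φ
    obtain ⟨x, rfl⟩ := (Module.bijective_dual_eval R (Fin n → R)).surjective ψ
    exact ⟨p x, rfl⟩

theorem exists_surjective_of_projective (R : Type u) [CommRing R] (N : Type u) [AddCommGroup N]
    [Module R N] : ∃ (P : Type u) (_ : AddCommGroup P) (_ : Module R P) (_ : Module.Projective R P)
      (π : P →ₗ[R] N), Function.Surjective π :=
  ⟨N →₀ R, inferInstance, inferInstance, inferInstance, Finsupp.linearCombination R id,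
    Finsupp.linearCombination_id_surjective R N⟩

/-- Over a self-injective ring, vanishing of `Ext^i(N, X*)` yields vanishing of
`Ext^i(X, N*)`. -/
theorem subsingleton_ext_dual [Module.Injective R R] {X M : Type u} [AddCommGroup X] [Module R X]
    [AddCommGroup M] [Module R M] (e : M ≃ₗ[R] Dual R X) (i : ℕ) :
    ∀ (N : Type u) [AddCommGroup N] [Module R N],
      Subsingleton (Ext.{u} (ModuleCat.of R N) (ModuleCat.of R M) (i + 1)) →
      Subsingleton (Ext.{u} (ModuleCat.of R X) (ModuleCat.of R (Dual R N)) (i + 1)) := by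
  induction i with
  | zero =>
    intro N _ _ h
    obtain ⟨P, _, _, _, π, hπ⟩ := exists_surjective_of_projective R N
    have hι := (LinearMap.ker π).injective_subtype
    have hex := LinearMap.exact_subtype_ker_map π
    have := injective_dual_of_projective (R := R) (A := P)
    have hs := dualMap_surjective_of_injective_self hι
    refine subsingleton_ext_one_of_exists_lift (LinearMap.dualMap_injective_of_surjective hπ)
      (dualMap_exact hex hπ) hs fun φ ↦ ?_
    obtain ⟨ψ, hψ⟩ := exists_extension_of_subsingleton_ext hι hex hπ h
      (e.symm.toLinearMap ∘ₗ φ.flip)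
    refine ⟨(e.toLinearMap ∘ₗ ψ).flip, LinearMap.ext fun x ↦ LinearMap.ext fun k ↦ ?_⟩
    have := congr(e ($hψ k) x)
    simpa using this
  | succ i ih =>
    intro N _ _ h
    obtain ⟨P, _, _, _, π, hπ⟩ := exists_surjective_of_projective R N
    have hι := (LinearMap.ker π).injective_subtype
    have hex := LinearMap.exact_subtype_ker_map π
    have := injective_dual_of_projective (R := R) (A := P)
    have hs := dualMap_surjective_of_injective_self hι
    exact subsingleton_ext_succ_of_injective (LinearMap.dualMap_injective_of_surjective hπ)
      (dualMap_exact hex hπ) hs _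
      (ih _ ((subsingleton_ext_succ_iff_of_projective hι hex hπ _ i.succ_pos).mp h))

/-- If `Ext¹(A*, N*) = 0` and `0 → A → B → C → 0` is exact, then `C* ⊗ N → B* ⊗ N` is
injective. -/
theorem rTensor_dualMap_injective [IsArtinianRing R] [IsLocalRing R] [Module.Injective R R]
    {f : A →ₗ[R] B} {g : B →ₗ[R] C}
    (hf : Function.Injective f) (hfg : Function.Exact f g) (hg : Function.Surjective g)
    {N : Type u} [AddCommGroup N] [Module R N]
    (h : Subsingleton (Ext.{u} (ModuleCat.of R (Dual R A)) (ModuleCat.of R (Dual R N)) 1)) :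
    Function.Injective (g.dualMap.rTensor N) := by
  refine (injective_iff_map_eq_zero _).mpr fun t ht ↦ ?_
  by_contra h0
  obtain ⟨θ, hθ⟩ := exists_dual_apply_ne_zero (R := R) h0
  -- A functional `θ` detecting `t` curries to `C* → N*`; extending it to `B*` factors `θ` through
  -- `B* ⊗ N`, where `t` dies.
  obtain ⟨ψ, hψ⟩ := exists_extension_of_subsingleton_ext
    (LinearMap.dualMap_injective_of_surjective hg) (dualMap_exact hfg hg)
    (dualMap_surjective_of_injective_self hf) h (TensorProduct.curry θ)
  have : θ = TensorProduct.lift ψ ∘ₗ g.dualMap.rTensor N :=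
    TensorProduct.ext' fun c n ↦ congr($hψ c n).symm
  exact hθ (by rw [this, LinearMap.comp_apply, ht, map_zero])

end Duality

/-! ### From Ext of duals back to Ext of the modules. -/

section Main

variable {R : Type u} [CommRing R]

theorem subsingleton_ext_of_extXi_lt {ξ : ℕ} (hξ : extXi R ≤ ξ) (X Y : ModuleCat.{u} R)
    [Module.Finite R X] (h : ∃ n : ℕ, ∀ i, n ≤ i → Subsingleton (Ext.{u} X Y i)) {i : ℕ}
    (hi : ξ < i) : Subsingleton (Ext.{u} X Y i) := by
  by_contra hn
  rw [not_subsingleton_iff_nontrivial] at hn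
  obtain ⟨n, h⟩ := h
  have hfin : extSup R X Y < ⊤ := by
    refine lt_of_le_of_lt (sSup_le ?_) (ENat.natCast_lt_top n)
    rintro _ ⟨j, rfl, hj⟩
    by_contra! hlt
    exact not_subsingleton_iff_nontrivial.mpr hj (h j (by exact_mod_cast hlt.le))
  have h₁ : (i : ℕ∞) ≤ extSup R X Y := le_sSup ⟨i, rfl, hn⟩
  have h₂ : extSup R X Y ≤ extXi R := le_sSup ⟨hfin, X, Y, inferInstance, rfl⟩
  have : i ≤ ξ := by exact_mod_cast h₁.trans (h₂.trans hξ)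
  omega

/-- `Ext^i(M*, N*)` vanishes for all large `i`. -/
def DualExtEventuallyVanishes (R : Type u) [CommRing R] (M N : Type u) [AddCommGroup M]
    [Module R M] [AddCommGroup N] [Module R N] : Prop :=
  ∃ n : ℕ, ∀ i, n ≤ i →
    Subsingleton (Ext.{u} (ModuleCat.of R (Dual R M)) (ModuleCat.of R (Dual R N)) i)

namespace DualExtEventuallyVanishes

variable {K F M N : Type u} [AddCommGroup K] [Module R K] [AddCommGroup F] [Module R F]
  [AddCommGroup M] [Module R M] [AddCommGroup N] [Module R N]

theorem shift [Module.Injective R R] {f : K →ₗ[R] F} {g : F →ₗ[R] M}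
    (hf : Function.Injective f) (hfg : Function.Exact f g) (hg : Function.Surjective g)
    [Module.Finite R F] [Module.Projective R F] (Y : ModuleCat.{u} R) {i : ℕ} (hi : 0 < i) :
    Subsingleton (Ext.{u} (ModuleCat.of R (Dual R K)) Y (i + 1)) ↔
      Subsingleton (Ext.{u} (ModuleCat.of R (Dual R M)) Y i) :=
  subsingleton_ext_succ_iff_of_projective (LinearMap.dualMap_injective_of_surjective hg)
    (dualMap_exact hfg hg) (dualMap_surjective_of_injective_self hf) Y hi

theorem syzygy [Module.Injective R R] {f : K →ₗ[R] F} {g : F →ₗ[R] M}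
    (hf : Function.Injective f) (hfg : Function.Exact f g) (hg : Function.Surjective g)
    [Module.Finite R F] [Module.Projective R F] (h : DualExtEventuallyVanishes R M N) :
    DualExtEventuallyVanishes R K N := by
  obtain ⟨n, h⟩ := h
  -- One unit for the shift, one to keep the shifted degree positive.
  refine ⟨n + 2, fun i hi ↦ ?_⟩
  obtain ⟨i, rfl⟩ : ∃ j, i = j + 1 := ⟨i - 1, by omega⟩
  exact (shift hf hfg hg _ (by omega)).mpr (h i (by omega))

theorem subsingleton_ext [IsNoetherianRing R] [Module.Injective R R] (hxi : extXi R < ⊤)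
    [Module.Finite R M] (h : DualExtEventuallyVanishes R M N) {i : ℕ} (hi : 0 < i) :
    Subsingleton (Ext.{u} (ModuleCat.of R (Dual R M)) (ModuleCat.of R (Dual R N)) i) := by
  obtain ⟨ξ, hξ⟩ := ENat.ne_top_iff_exists.mp hxi.ne
  -- Passing from `M` to a syzygy raises the degree by one; `j` such steps bring it above `ξ`.
  have key (j : ℕ) : ∀ (M : Type u) [AddCommGroup M] [Module R M] [Module.Finite R M] (i : ℕ),
      DualExtEventuallyVanishes R M N → 0 < i → ξ < i + j →
        Subsingleton (Ext.{u} (ModuleCat.of R (Dual R M)) (ModuleCat.of R (Dual R N)) i) := by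
    induction j with
    | zero =>
      intro M _ _ _ i h _ hi
      exact subsingleton_ext_of_extXi_lt hξ.ge _ _ h hi
    | succ j ih =>
      intro M _ _ _ i h hi hij
      obtain ⟨n, p, hp⟩ := Module.Finite.exists_fin' R M
      have hι := (LinearMap.ker p).injective_subtype
      have hex := LinearMap.exact_subtype_ker_map p
      exact (shift hι hex hp _ hi).mp (ih _ (i + 1) (h.syzygy hι hex hp) i.succ_pos (by omega))
  exact key ξ M i h hi (by omega)

/-- Compare with free modules, where the map is bijective: `φ ∘ p` comes from a tensor `t`, which
descends to `M* ⊗ N` once its image in `(ker p)* ⊗ N` vanishes. That vanishing is tested in the dual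
of a free cover of `ker p`. -/
theorem dualTensorHom_surjective [IsArtinianRing R] [IsLocalRing R] [Module.Injective R R]
    (hxi : extXi R < ⊤) [Module.Finite R M] (h : DualExtEventuallyVanishes R M N) :
    Function.Surjective (dualTensorHom R M N) := by
  intro φ
  obtain ⟨n, p, hp⟩ := Module.Finite.exists_fin' R M
  have hι := (LinearMap.ker p).injective_subtype
  have hex := LinearMap.exact_subtype_ker_map p
  obtain ⟨m, q, hq⟩ := Module.Finite.exists_fin' R (LinearMap.ker p)
  have hκ := (LinearMap.ker q).injective_subtype
  have hex' := LinearMap.exact_subtype_ker_map q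
  set ι := (LinearMap.ker p).subtype
  -- `ker q` is a second syzygy of `M`; vanishing for its dual embeds `(ker p)* ⊗ N` into `(R^m)* ⊗
  -- N`.
  have hinj := rTensor_dualMap_injective hκ hex' hq (N := N)
    (((h.syzygy hι hex hp).syzygy hκ hex' hq).subsingleton_ext hxi one_pos)
  obtain ⟨t, ht⟩ := (dualTensorHom_bijective (R := R) (M := Fin n → R) (N := N)).surjective
    (φ ∘ₗ p)
  have ht0 : ι.dualMap.rTensor N t = 0 := by
    apply hinj
    rw [map_zero]
    apply (dualTensorHom_bijective (R := R) (M := Fin m → R) (N := N)).injective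
    rw [map_zero, ← LinearMap.comp_apply (dualTensorHom R _ N),
      dualTensorHom_comp_rTensor_dualMap, LinearMap.comp_apply,
      ← LinearMap.comp_apply (dualTensorHom R _ N), dualTensorHom_comp_rTensor_dualMap,
      LinearMap.comp_apply, ht]
    ext x
    have : p (ι (q (Pi.single x 1))) = 0 := (q (Pi.single x 1)).2
    simp [this]
  obtain ⟨s, rfl⟩ := (rTensor_exact N (dualMap_exact hex hp)
    (dualMap_surjective_of_injective_self hι) t).mp ht0
  refine ⟨s, ?_⟩
  rw [← LinearMap.comp_apply (dualTensorHom R _ N), dualTensorHom_comp_rTensor_dualMap] at ht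
  exact LinearMap.ext fun x ↦ by
    obtain ⟨y, rfl⟩ := hp x
    exact congr($ht y)

theorem subsingleton_ext_of_dual [IsArtinianRing R] [IsLocalRing R] [Module.Injective R R]
    (hxi : extXi R < ⊤) (i : ℕ) : ∀ (M : Type u) [AddCommGroup M] [Module R M]
      [Module.Finite R M], DualExtEventuallyVanishes R M N →
      Subsingleton (Ext.{u} (ModuleCat.of R M) (ModuleCat.of R N) (i + 1)) := by
  induction i with
  | zero =>
    intro M _ _ _ h
    obtain ⟨n, p, hp⟩ := Module.Finite.exists_fin' R M
    have hι := (LinearMap.ker p).injective_subtype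
    have hex := LinearMap.exact_subtype_ker_map p
    refine subsingleton_ext_one_of_exists_extension hι hex hp fun φ ↦ ?_
    obtain ⟨s, rfl⟩ := (h.syzygy hι hex hp).dualTensorHom_surjective hxi φ
    obtain ⟨t, rfl⟩ := LinearMap.rTensor_surjective N
      (dualMap_surjective_of_injective_self hι) s
    exact ⟨dualTensorHom R _ N t,
      congr($(dualTensorHom_comp_rTensor_dualMap (P := N) (LinearMap.ker p).subtype) t).symm⟩
  | succ i ih =>
    intro M _ _ _ h
    obtain ⟨n, p, hp⟩ := Module.Finite.exists_fin' R M
    have hι := (LinearMap.ker p).injective_subtype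
    have hex := LinearMap.exact_subtype_ker_map p
    exact (subsingleton_ext_succ_iff_of_projective hι hex hp _ i.succ_pos).mpr
      (ih _ (h.syzygy hι hex hp))

end DualExtEventuallyVanishes

end Main

theorem corollary3p2 (R : Type u) [CommRing R] [IsArtinianRing R] [IsGorensteinLocalRing R]
    (hxi : extXi R < ⊤) (M N : ModuleCat.{u} R) [Module.Finite R M]
    (h : ∃ n : ℕ, ∀ i : ℕ, n ≤ i → Subsingleton (Abelian.Ext.{u} N M i)) :
    ∀ i : ℕ, 0 < i → Subsingleton (Abelian.Ext.{u} M N i) := by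
  have := IsGorensteinLocalRing.injective_self R
  have hdual : DualExtEventuallyVanishes R M N := by
    obtain ⟨n, h⟩ := h
    -- Degree `0` is skipped, since the duality lemma concerns positive degrees only.
    refine ⟨n + 1, fun i hi ↦ ?_⟩
    obtain ⟨i, rfl⟩ : ∃ j, i = j + 1 := ⟨i - 1, by omega⟩
    exact subsingleton_ext_dual (LinearEquiv.ofBijective _ bijective_dual_eval_of_finite) i N
      (h (i + 1) (by omega))
  intro i hi
  obtain ⟨i, rfl⟩ : ∃ j, i = j + 1 := ⟨i - 1, by omega⟩
  exact DualExtEventuallyVanishes.subsingleton_ext_of_dual hxi i M hdual
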